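/- Let $m,n\ge 1$ and let $\mathbf r=(r_1,\dots,r_m)$, $\mathbf s=(s_1,\dots,s_n)$ be tuples of positive reals with $r_1\ge\dots\ge r_m$, $s_1\ge\dots\ge s_n$ and $\sum_i r_i=1=\sum_j s_j$. For $x\in\mathbb R^m$ and $y\in\mathbb R^n$ put $\|x\|_{\mathbf r}=\max_i|x_i|^{1/r_i}$, $\|y\|_{\mathbf s}=\max_j|y_j|^{1/s_j}$ and $\langle x\rangle_{\mathbf r}=\inf_{p\in\mathbb Z^m}\|x-p\|_{\mathbf r}$. For $A\in M_{m,n}(\mathbb R)$ and $\varepsilon>0$ let $$\mathbf{Bad}_A(\varepsilon)=\Big\{b\in\mathbb R^m:\ \liminf_{q\in\mathbb Z^n,\ \|q\|_{\mathbf s}\to\infty}\|q\|_{\mathbf s}\,\langle Aq-b\rangle_{\mathbf r}\ge\varepsilon\Big\}.$$ Call $A$ singular on average if for every $\varepsilon>0$ $$\lim_{N\to\infty}\frac1N\Big|\Big\{l\in\{1,\dots,N\}:\ \exists q\in\mathbb Z^n \text{ with } \langle Aq\rangle_{\mathbf r}<\varepsilon 2^{-l}\text{ and }0<\|q\|_{\mathbf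 s}<2^l\Big\}\Big|=1 .$$ If $A\in M_{m,n}(\mathbb R)$ is not singular on average, then for every $\varepsilon_0<1$ there is a constant $c>0$, depending only on $A$, $\mathbf r$, $\mathbf s$ and $\varepsilon_0$ (so, for instance with $\varepsilon_0=1/2$, on $A$ and the weights only), such that for all $0<\varepsilon\le\varepsilon_0$ $$\dim_H\mathbf{Bad}_A(\varepsilon)\le m-c\,\frac{\varepsilon}{\log(1/\varepsilon)},$$ where $\dim_H$ is the Hausdorff dimension with respect to the standard metric on $\mathbb R^m$. -/

import Mathlib

open Filter Topology

noncomputable section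

/-- The weighted quasinorm `max_i |x_i|^(1/w_i)` on `ℝ^k` (used with positive weights, `k ≥ 1`). -/
def quasinorm {k : ℕ} (w : Fin k → ℝ) (x : Fin k → ℝ) : ℝ :=
  ⨆ i, |x i| ^ (1 / w i)

/-- The distance `inf_{p ∈ ℤ^k} ‖x - p‖_w` to the integer vectors in the weighted quasinorm. -/
def intDist {k : ℕ} (w : Fin k → ℝ) (x : Fin k → ℝ) : ℝ :=
  ⨅ p : Fin k → ℤ, quasinorm w (fun i => x i - (p i : ℝ))

/-- An integer vector seen as a real vector. -/
def intVec {k : ℕ} (q : Fin k → ℤ) : Fin k → ℝ := fun j => (q j : ℝ)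

/-- `A` is `ε`-bad for `b`: the lower limit of `‖q‖_s ⟨Aq - b⟩_r`, as `q` runs through `ℤ^n` with
`‖q‖_s → ∞`, is at least `ε`. The lower limit is taken in the extended reals, so that it may
be `+∞`. -/
def IsBadFor {m n : ℕ} (r : Fin m → ℝ) (s : Fin n → ℝ) (A : Matrix (Fin m) (Fin n) ℝ)
    (ε : ℝ) (b : Fin m → ℝ) : Prop :=
  (ε : EReal) ≤
    liminf (fun q : Fin n → ℤ =>
        ((quasinorm s (intVec q) * intDist r (A.mulVec (intVec q) - b) : ℝ) : EReal))
      (comap (fun q : Fin n → ℤ => quasinorm s (intVec q)) atTop)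

/-- The set of targets `b ∈ ℝ^m` for which `A` is `ε`-bad. -/
def BadTargets {m n : ℕ} (r : Fin m → ℝ) (s : Fin n → ℝ) (A : Matrix (Fin m) (Fin n) ℝ)
    (ε : ℝ) : Set (Fin m → ℝ) :=
  {b | IsBadFor r s A ε b}

/-- `A` is singular on average with respect to the weights `r`, `s`. -/
def SingularOnAverage {m n : ℕ} (r : Fin m → ℝ) (s : Fin n → ℝ)
    (A : Matrix (Fin m) (Fin n) ℝ) : Prop :=
  ∀ ε : ℝ, 0 < ε →
    Tendsto (fun N : ℕ =>
        (({l : ℕ | l ∈ Set.Icc 1 N ∧ ∃ q : Fin n → ℤ,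
            intDist r (A.mulVec (intVec q)) < ε * (2 : ℝ) ^ (-(l : ℤ)) ∧
            0 < quasinorm s (intVec q) ∧ quasinorm s (intVec q) < (2 : ℝ) ^ l}.ncard : ℕ) : ℝ)
          / (N : ℝ))
      atTop (𝓝 1)

end

/-! Failure of singularity on average yields `η`, `δ > 0` and arbitrarily large `N` such that at
least `δN` of the scales `X = 2^l`, `l ≤ N`, are good: the unimodular lattice of vectors `(X^r (Aq +
p), X^(-s) q)` has no nonzero vector of sup norm below `η`. Its covering radius is then bounded
(`exists_int_near`), so every `b` has a point `Aq + p` within `R / X^r` of it with `‖q‖_s`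
comparable to `X`. Targets satisfying the bad inequality for all large `q` avoid a box of weighted
radius `κ / X`, `κ ≍ ε`, about that point (`exists_hole_of_isGoodScale`).

Holes near every point make the volume of the weighted neighbourhood drop by a factor `1 + const *
ε` (`volume_boxNhd_decay`) over `G` dyadic steps, with `G` at most a constant times `log(1/ε)`.
Drops from nearby good scales overlap; multiplying `G` consecutive volumes accounts for this
(`pow_card_mul_pow_le`), at the cost of dividing the exponent by `G`. The outcome is a power saving
with exponent `τ ≍ ε / log(1/ε)` along a sequence of scales, which is enough for Hausdorff dimension
(`dimH_le_of_frequently_volume_le`). -/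

/-! ### Geometry of numbers: covering radius of lattices without short vectors -/

open MeasureTheory in
/-- A set whose translates by nonzero integer vectors miss it has volume at most one. -/
theorem volume_le_one_of_disjoint_int_translates {ι : Type*} [Fintype ι] (S : Set (ι → ℝ))
    (hS : MeasurableSet S)
    (hd : ∀ z : ι → ℤ, ∀ x ∈ S, ∀ y ∈ S, (∀ i, y i - x i = (z i : ℝ)) → z = 0) :
    volume S ≤ 1 := by
  classical
  by_contra hlt
  push Not at hlt
  have fund := ZSpan.isAddFundamentalDomain' (Pi.basisFun ℝ ι) volume
  have hvol : volume (ZSpan.fundamentalDomain (Pi.basisFun ℝ ι)) = 1 := by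
    rw [ZSpan.fundamentalDomain_pi_basisFun, volume_pi, Measure.pi_pi]
    simp
  have : Countable (Submodule.span ℤ (Set.range (Pi.basisFun ℝ ι))).toAddSubgroup := by
    change Countable (Submodule.span ℤ (Set.range (Pi.basisFun ℝ ι)))
    infer_instance
  -- Blichfeldt: volume above the covolume forces two distinct lattice translates to meet.
  obtain ⟨x, y, hxy, hnd⟩ := exists_pair_mem_lattice_not_disjoint_vadd fund
    hS.nullMeasurableSet (by rwa [hvol])
  rw [Set.not_disjoint_iff] at hnd
  obtain ⟨w, ⟨u, hu, hw⟩, ⟨v, hv, hw'⟩⟩ := hnd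
  have hw1 : (x : ι → ℝ) + u = w := hw
  have hw2 : (y : ι → ℝ) + v = w := hw'
  have key : ∀ x : (Submodule.span ℤ (Set.range (Pi.basisFun ℝ ι))).toAddSubgroup,
      ∃ z : ι → ℤ, ∀ i, (x : ι → ℝ) i = z i := by
    rintro ⟨x, hx⟩
    have hx' := ((Pi.basisFun ℝ ι).mem_span_iff_repr_mem ℤ x).1 hx
    choose z hz using hx'
    exact ⟨z, fun i => by simpa using (hz i).symm⟩
  obtain ⟨zx, hzx⟩ := key x
  obtain ⟨zy, hzy⟩ := key y
  have h0 := hd (zx - zy) u hu v hv (fun i => by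
    have h1 := congrFun (hw1.trans hw2.symm) i
    simp only [Pi.add_apply, hzx, hzy] at h1
    simp only [Pi.sub_apply]; push_cast; linarith)
  apply hxy
  ext i
  rw [hzx, hzy, sub_eq_zero.1 h0]

open MeasureTheory in
/-- A unimodular lattice without short vectors has bounded covering radius. -/
theorem exists_int_near {ι : Type*} [Fintype ι] [DecidableEq ι] (M : Matrix ι ι ℝ)
    (hdet : M.det = 1) {η : ℝ} (hη : 0 < η)
    (hshort : ∀ z : ι → ℤ, z ≠ 0 → η ≤ ‖M.mulVec (fun i => (z i : ℝ))‖)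
    (K : ℕ) (hK : 1 < K * η ^ Fintype.card ι) (w : ι → ℝ) :
    ∃ z : ι → ℤ, ‖w - M.mulVec (fun i => (z i : ℝ))‖ ≤ K * η := by
  by_contra hcon
  push Not at hcon
  set Λ : Set (ι → ℝ) := Set.range fun z : ι → ℤ => M.mulVec (fun i => (z i : ℝ)) with hΛ
  have hne : Λ.Nonempty := Set.range_nonempty _
  set f : (ι → ℝ) → ℝ := fun y => Metric.infDist y Λ with hf
  have hf0 : f 0 = 0 := by
    apply Metric.infDist_zero_of_mem
    exact ⟨0, by simp [← Pi.zero_def]⟩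
  have hfw : K * η ≤ f w := by
    apply (Metric.le_infDist hne).2
    rintro _ ⟨z, rfl⟩
    rw [dist_eq_norm]
    exact (hcon z).le
  have hfinv : ∀ (z : ι → ℤ) y, f (y + M.mulVec (fun i => (z i : ℝ))) ≤ f y := by
    intro z y
    apply (Metric.le_infDist hne).2
    rintro _ ⟨z', rfl⟩
    have hmem : M.mulVec (fun i => ((z' + z) i : ℝ)) ∈ Λ := ⟨z' + z, rfl⟩
    refine (Metric.infDist_le_dist_of_mem hmem).trans (le_of_eq ?_)
    have : (M.mulVec fun i => ((z' + z) i : ℝ))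
        = M.mulVec (fun i => (z' i : ℝ)) + M.mulVec (fun i => (z i : ℝ)) := by
      rw [← Matrix.mulVec_add]
      congr 1
      ext i
      simp
    rw [this, dist_add_right]
  -- Along the segment from `0` to a badly approximated `w`, the distance to the lattice takes every
  -- value `k * η` with `k < K`. Balls of radius `η / 2` about such points will be disjoint modulo
  -- the lattice, and `K` of them have too much volume.
  have hex : ∀ k : ℕ, k < K → ∃ y, f y = k * η := by
    intro k hk
    have hc : Continuous fun t : ℝ => f (t • w) :=
      (Metric.continuous_infDist_pt Λ).comp (continuous_id.smul continuous_const)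
    have := intermediate_value_Icc (zero_le_one' ℝ) hc.continuousOn
    obtain ⟨t, -, ht⟩ := this (show (k * η : ℝ) ∈ _ by
      simp only [zero_smul, one_smul, hf0]
      refine ⟨by positivity, le_trans ?_ hfw⟩
      have : (k : ℝ) ≤ K := by exact_mod_cast hk.le
      gcongr)
    exact ⟨_, ht⟩
  have hex' : ∀ k : ℕ, ∃ y, k < K → f y = k * η := by
    intro k
    by_cases hk : k < K
    · obtain ⟨y, hy⟩ := hex k hk
      exact ⟨y, fun _ => hy⟩
    · exact ⟨0, fun h => absurd h hk⟩
  choose y hy using hex'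
  have hdetL : LinearMap.det (Matrix.toLin' M) = 1 := by rw [LinearMap.det_toLin', hdet]
  -- Pulling back by `M` turns the lattice into `ℤ^ι` and, as the determinant is one, keeps volumes.
  set B : ℕ → Set (ι → ℝ) := fun k => Matrix.toLin' M ⁻¹' Metric.ball (y k) (η / 2) with hB
  have hBvol : ∀ k, volume (B k) = ENNReal.ofReal (η ^ Fintype.card ι) := by
    intro k
    rw [hB, Measure.addHaar_preimage_linearMap _ (by rw [hdetL]; exact one_ne_zero), hdetL,
      Real.volume_pi_ball _ (by positivity), mul_div_cancel₀ _ two_ne_zero]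
    simp
  have hBmeas : ∀ k, MeasurableSet (B k) := by
    intro k
    exact (Metric.isOpen_ball.preimage (LinearMap.continuous_of_finiteDimensional _)).measurableSet
  have hsep : ∀ j < K, ∀ k < K, ∀ u ∈ B j, ∀ v ∈ B k, ∀ z : ι → ℤ,
      (∀ i, v i - u i = (z i : ℝ)) → j = k ∧ z = 0 := by
    intro j hj k hk u hu v hv z hz
    have hvu : v = u + fun i => (z i : ℝ) := by ext i; simp [← hz i]
    simp only [hB, Set.mem_preimage, Metric.mem_ball, Matrix.toLin'_apply] at hu hv
    rw [hvu, Matrix.mulVec_add] at hv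
    set zz := M.mulVec (fun i => (z i : ℝ)) with hzz
    have hd : dist (y j + zz) (y k) < η := by
      calc dist (y j + zz) (y k) ≤ dist (y j + zz) (M.mulVec u + zz) + dist (M.mulVec u + zz) (y k) :=
            dist_triangle _ _ _
        _ < η / 2 + η / 2 := by
            rw [dist_add_right, dist_comm]
            exact add_lt_add hu hv
        _ = η := by ring
    -- The distance to the lattice is invariant and 1-Lipschitz, so levels `j * η` and `k * η` at
    -- points less than `η` apart agree.
    have hjk : j = k := by
      have h1 : f (y j + zz) = f (y j) := by
        apply le_antisymm (hfinv z _)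
        have := hfinv (-z) (y j + zz)
        have hneg : M.mulVec (fun i => ((-z) i : ℝ)) = -zz := by
          rw [hzz, ← Matrix.mulVec_neg]; congr 1; ext i; simp
        rwa [hneg, add_neg_cancel_right] at this
      have h2 : |f (y j + zz) - f (y k)| < η := by
        have := (Metric.lipschitz_infDist_pt Λ).dist_le_mul (y j + zz) (y k)
        rw [Real.dist_eq] at this
        simp only [NNReal.coe_one, one_mul] at this
        exact this.trans_lt hd
      rw [h1, hy j hj, hy k hk, ← sub_mul, abs_mul, abs_of_pos hη] at h2
      have h3 : |(j : ℝ) - k| < 1 := by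
        by_contra h; push Not at h; nlinarith
      have h4 : |(j : ℤ) - k| < 1 := by exact_mod_cast h3
      have := Int.abs_lt_one_iff.1 h4
      omega
    refine ⟨hjk, ?_⟩
    by_contra hz0
    have := hshort z hz0
    rw [hjk, dist_eq_norm, add_sub_cancel_left] at hd
    exact absurd hd (not_lt.2 this)
  have hvol : volume (⋃ k ∈ Finset.range K, B k) = K * ENNReal.ofReal (η ^ Fintype.card ι) := by
    rw [measure_biUnion_finset _ fun k _ => hBmeas k]
    · simp [hBvol]
    · intro j hj k hk hjk
      apply Set.disjoint_left.2
      intro u hu hv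
      exact hjk (hsep j (by simpa using hj) k (by simpa using hk) u hu u hv 0 (by simp)).1
  have hle := volume_le_one_of_disjoint_int_translates (⋃ k ∈ Finset.range K, B k)
    (Finset.measurableSet_biUnion _ fun k _ => hBmeas k) (by
      intro z u hu v hv hz
      simp only [Set.mem_iUnion, Finset.mem_range, exists_prop] at hu hv
      obtain ⟨j, hj, hu⟩ := hu
      obtain ⟨k, hk, hv⟩ := hv
      exact (hsep j hj k hk u hu v hv z hz).2)
  rw [hvol, ← ENNReal.ofReal_natCast, ← ENNReal.ofReal_mul (by positivity),
    ENNReal.ofReal_le_one] at hle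
  linarith

/-! ### Box neighbourhoods and holes -/

/-- The open box with centre `x` and half-sides `a`. -/
def box {m : ℕ} (x a : Fin m → ℝ) : Set (Fin m → ℝ) := {y | ∀ i, |y i - x i| < a i}

/-- The union of the boxes with half-sides `a` centred in `E`. -/
def boxNhd {m : ℕ} (E : Set (Fin m → ℝ)) (a : Fin m → ℝ) : Set (Fin m → ℝ) := ⋃ b ∈ E, box b a

theorem mem_boxNhd {m : ℕ} {E : Set (Fin m → ℝ)} {a y : Fin m → ℝ} :
    y ∈ boxNhd E a ↔ ∃ b ∈ E, ∀ i, |y i - b i| < a i := by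
  simp [boxNhd, box]

theorem box_eq_pi {m : ℕ} (x a : Fin m → ℝ) :
    box x a = Set.pi Set.univ fun i => Set.Ioo (x i - a i) (x i + a i) := by
  ext y
  simp only [box, Set.mem_ofPred_eq, Set.mem_pi, Set.mem_univ, true_imp_iff, Set.mem_Ioo, abs_lt]
  refine forall_congr' fun i => ⟨fun h => ⟨by linarith, by linarith⟩,
    fun h => ⟨by linarith, by linarith⟩⟩

theorem isOpen_box {m : ℕ} (x a : Fin m → ℝ) : IsOpen (box x a) := by
  rw [box_eq_pi]
  exact isOpen_set_pi Set.finite_univ fun _ _ => isOpen_Ioo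

theorem isOpen_boxNhd {m : ℕ} (E : Set (Fin m → ℝ)) (a : Fin m → ℝ) : IsOpen (boxNhd E a) :=
  isOpen_biUnion fun _ _ => isOpen_box _ _

open MeasureTheory in
theorem volume_box {m : ℕ} (x a : Fin m → ℝ) (ha : ∀ i, 0 ≤ a i) :
    volume (box x a) = ENNReal.ofReal (∏ i, (2 * a i)) := by
  rw [box_eq_pi, Real.volume_pi_Ioo,
    ENNReal.ofReal_prod_of_nonneg fun i _ => mul_nonneg zero_le_two (ha i)]
  refine Finset.prod_congr rfl fun i _ => ?_
  congr 1
  ring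

theorem boxNhd_mono {m : ℕ} (E : Set (Fin m → ℝ)) {a a' : Fin m → ℝ} (h : ∀ i, a i ≤ a' i) :
    boxNhd E a ⊆ boxNhd E a' := by
  intro y hy
  obtain ⟨b, hb, hy⟩ := mem_boxNhd.1 hy
  exact mem_boxNhd.2 ⟨b, hb, fun i => (hy i).trans_le (h i)⟩

/-- A maximal disjoint family of boxes centred in `E`; their threefold enlargements cover. -/
theorem exists_disjoint_boxes {m : ℕ} (E : Set (Fin m → ℝ)) {a : Fin m → ℝ} (ha : ∀ i, 0 < a i) :
    ∃ u ⊆ E, u.Countable ∧ u.PairwiseDisjoint (fun b => box b a) ∧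
      ∀ e ∈ E, ∃ b ∈ u, ∀ i, |e i - b i| < 2 * a i := by
  have hmem : ∀ b, b ∈ box b a := fun b i => by simpa using ha i
  -- All boxes have the same shape, so a constant size function serves in Vitali's lemma.
  obtain ⟨u, huE, hdisj, hcov⟩ := Vitali.exists_disjoint_subfamily_covering_enlargement
    (fun b => box b a) E (fun _ => 1) 2 one_lt_two (fun _ _ => zero_le_one) 1 (fun _ _ => le_rfl)
    (fun b _ => ⟨b, hmem b⟩)
  refine ⟨u, huE, hdisj.countable_of_isOpen (fun b _ => isOpen_box b a) (fun b _ => ⟨b, hmem b⟩),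
    hdisj, fun e he => ?_⟩
  obtain ⟨b, hb, ⟨y, hy1, hy2⟩, -⟩ := hcov e he
  refine ⟨b, hb, fun i => ?_⟩
  have h1 := hy1 i
  have h2 := hy2 i
  rw [abs_lt] at *
  constructor <;> linarith

open MeasureTheory in
/-- If near every point of `E` there is a hole of half-sides `2 * h`, then the volume of the
`h`-neighbourhood of `E` is smaller than that of the `a`-neighbourhood by a definite factor. -/
theorem volume_boxNhd_of_holes {m : ℕ} (E : Set (Fin m → ℝ)) {a h : Fin m → ℝ}
    (hh : ∀ i, 0 < h i) (hha : ∀ i, h i ≤ a i)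
    (hole : ∀ b ∈ E, ∃ x : Fin m → ℝ, (∀ i, |x i - b i| + h i ≤ a i) ∧
      ∀ e ∈ E, ∃ i, 2 * h i ≤ |e i - x i|) :
    volume (boxNhd E h) * (1 + ENNReal.ofReal (∏ i, (h i / (3 * a i)))) ≤ volume (boxNhd E a) := by
  have ha : ∀ i, 0 < a i := fun i => (hh i).trans_le (hha i)
  obtain ⟨u, huE, hcount, hdisj, hcov⟩ := exists_disjoint_boxes E ha
  choose! x hxa hxE using hole
  -- One hole per selected box: these are disjoint from each other and from the `h`-neighbourhood,
  -- while the threefold boxes cover that neighbourhood. Comparing the two totals box by box gives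
  -- the ratio `∏ h / (3 * a)`.
  set H : Set (Fin m → ℝ) := ⋃ b ∈ u, box (x b) h with hH
  have hsub : ∀ b ∈ E, box (x b) h ⊆ box b a := by
    intro b hb y hy i
    have h1 := hy i
    have h2 := hxa b hb i
    have h3 := abs_sub_le (y i) (x b i) (b i)
    linarith
  have hHvol : volume H = ∑' _ : u, ENNReal.ofReal (∏ i, (2 * h i)) := by
    rw [hH, measure_biUnion hcount]
    · exact tsum_congr fun b => volume_box _ _ fun i => (hh i).le
    · intro b hb c hc hbc
      exact (hdisj hb hc hbc).mono (hsub b (huE hb)) (hsub c (huE hc))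
    · exact fun b _ => (isOpen_box _ _).measurableSet
  have hNvol : volume (boxNhd E h) ≤ ∑' _ : u, ENNReal.ofReal (∏ i, (2 * (3 * a i))) := by
    have : boxNhd E h ⊆ ⋃ b ∈ u, box b (fun i => 3 * a i) := by
      intro y hy
      obtain ⟨e, he, hy⟩ := mem_boxNhd.1 hy
      obtain ⟨b, hb, heb⟩ := hcov e he
      refine Set.mem_biUnion hb fun i => ?_
      have h1 := hy i
      have h2 := heb i
      have h3 := abs_sub_le (y i) (e i) (b i)
      have h4 := hha i
      linarith
    refine (measure_mono this).trans ((measure_biUnion_le _ hcount _).trans (le_of_eq ?_))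
    exact tsum_congr fun b => volume_box _ _ fun i => by have := ha i; positivity
  have hle : volume (boxNhd E h) * ENNReal.ofReal (∏ i, (h i / (3 * a i))) ≤ volume H := by
    refine (mul_le_mul_left hNvol _).trans (le_of_eq ?_)
    rw [hHvol, ← ENNReal.tsum_mul_right]
    refine tsum_congr fun _ => ?_
    rw [← ENNReal.ofReal_mul (Finset.prod_nonneg fun i _ => by have := ha i; positivity),
      ← Finset.prod_mul_distrib]
    congr 1
    refine Finset.prod_congr rfl fun i _ => ?_
    have := (ha i).ne'
    field_simp
  have hHd : Disjoint (boxNhd E h) H := by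
    rw [Set.disjoint_left]
    intro y hy hyH
    obtain ⟨e, he, hy⟩ := mem_boxNhd.1 hy
    simp only [hH, Set.mem_iUnion, exists_prop] at hyH
    obtain ⟨b, hb, hyb⟩ := hyH
    obtain ⟨i, hi⟩ := hxE b (huE hb) e he
    have h1 := hy i
    have h2 := hyb i
    have h3 := abs_sub_le (e i) (y i) (x b i)
    rw [abs_sub_comm (e i) (y i)] at h3
    linarith
  calc volume (boxNhd E h) * (1 + ENNReal.ofReal (∏ i, (h i / (3 * a i))))
      = volume (boxNhd E h) + volume (boxNhd E h) * ENNReal.ofReal (∏ i, (h i / (3 * a i))) := by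
        rw [mul_add, mul_one]
    _ ≤ volume (boxNhd E h) + volume H := by gcongr
    _ = volume (boxNhd E h ∪ H) := (measure_union' hHd (isOpen_boxNhd E h).measurableSet).symm
    _ ≤ volume (boxNhd E a) := by
        refine measure_mono (Set.union_subset (boxNhd_mono E hha) ?_)
        refine Set.iUnion₂_subset fun b hb => (hsub b (huE hb)).trans ?_
        exact Set.subset_biUnion_of_mem (u := fun b => box b a) (huE hb)

/-! ### From volumes of neighbourhoods to Hausdorff dimension -/

open MeasureTheory ENNReal in
/-- A volume bound for small cubical neighbourhoods bounds the Hausdorff dimension. -/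
theorem dimH_le_of_frequently_volume_le {m : ℕ} (E : Set (Fin m → ℝ)) {C τ : ℝ} (hC : 0 ≤ C)
    (hτ : τ ≤ m)
    (h : ∀ δ₀ > 0, ∃ δ, 0 < δ ∧ δ < δ₀ ∧
      volume (boxNhd E fun _ => δ) ≤ ENNReal.ofReal (C * δ ^ τ)) :
    dimH E ≤ ENNReal.ofReal (m - τ) := by
  have hd : (0 : ℝ) ≤ m - τ := sub_nonneg.2 hτ
  have h' : ∀ k : ℕ, ∃ δ : ℝ, 0 < δ ∧ δ < 1 / ((k : ℝ) + 1) ∧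
      volume (boxNhd E fun _ => δ) ≤ ENNReal.ofReal (C * δ ^ τ) :=
    fun k => h _ (by positivity)
  choose δ hδ hδk hvol using h'
  have hcov := fun k => exists_disjoint_boxes E (a := fun _ => δ k) (fun _ => hδ k)
  choose u huE hcount hdisj hucov using hcov
  have hcnt : ∀ k, Countable (u k) := fun k => (hcount k).to_subtype
  -- The disjoint boxes of half-side `δ k` fit in the neighbourhood, so there are at most a constant
  -- times `δ k ^ (τ - m)` of them; hence the sums of `diam ^ (m - τ)` over these covering balls
  -- stay bounded.
  set t : ∀ k, u k → Set (Fin m → ℝ) := fun k b => Metric.closedBall (b : Fin m → ℝ) (2 * δ k)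
    with ht
  have hdiam : ∀ k b, Metric.ediam (t k b) ≤ ENNReal.ofReal (4 * δ k) := by
    intro k b
    refine Metric.ediam_le fun x hx y hy => ?_
    rw [edist_dist]
    refine ENNReal.ofReal_le_ofReal ((dist_triangle_right x y b).trans ?_)
    have hx' := Metric.mem_closedBall.1 hx
    have hy' := Metric.mem_closedBall.1 hy
    linarith
  have hmain := Measure.hausdorffMeasure_le_liminf_tsum (m - τ) E (l := atTop)
    (fun k => ENNReal.ofReal (4 * δ k)) (by
      rw [← ENNReal.ofReal_zero]
      refine ENNReal.tendsto_ofReal ?_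
      have h1 : Tendsto (fun k : ℕ => 4 * (1 / ((k : ℝ) + 1))) atTop (𝓝 (4 * 0)) :=
        tendsto_one_div_add_atTop_nhds_zero_nat.const_mul 4
      rw [mul_zero] at h1
      exact squeeze_zero (fun k => by linarith [hδ k]) (fun k => by linarith [hδk k]) h1)
    t (Eventually.of_forall fun k b => hdiam k b)
    (Eventually.of_forall fun k e he => by
      obtain ⟨b, hb, hbe⟩ := hucov k e he
      refine Set.mem_iUnion.2 ⟨⟨b, hb⟩, ?_⟩
      rw [Metric.mem_closedBall, dist_pi_le_iff (by linarith [hδ k])]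
      exact fun i => by rw [Real.dist_eq]; exact (hbe i).le)
  have hbound : ∀ k, ∑' b, Metric.ediam (t k b) ^ ((m : ℝ) - τ)
      ≤ ENNReal.ofReal (C * (4 ^ ((m : ℝ) - τ) / 2 ^ m)) := by
    intro k
    have hδ' := hδ k
    have hsum : ∑' _ : u k, ENNReal.ofReal ((2 * δ k) ^ m) ≤ ENNReal.ofReal (C * δ k ^ τ) := by
      refine le_trans (le_of_eq ?_) ((measure_mono
        (Set.biUnion_subset_biUnion_left (huE k))).trans (hvol k))
      rw [measure_biUnion (hcount k) (hdisj k) fun b _ => (isOpen_box _ _).measurableSet]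
      refine tsum_congr fun b => ?_
      rw [volume_box _ _ fun _ => hδ'.le]
      simp
    have hterm : ∀ b, Metric.ediam (t k b) ^ ((m : ℝ) - τ) ≤ ENNReal.ofReal ((2 * δ k) ^ m) *
        ENNReal.ofReal (4 ^ ((m : ℝ) - τ) / 2 ^ m * δ k ^ (-τ)) := by
      intro b
      refine (ENNReal.rpow_le_rpow (hdiam k b) hd).trans (le_of_eq ?_)
      rw [ENNReal.ofReal_rpow_of_nonneg (by positivity) hd, ← ENNReal.ofReal_mul (by positivity)]
      congr 1
      rw [Real.mul_rpow (by norm_num) hδ'.le, sub_eq_add_neg (m : ℝ), Real.rpow_add hδ',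
        Real.rpow_natCast, mul_pow]
      field_simp
    calc ∑' b, Metric.ediam (t k b) ^ ((m : ℝ) - τ)
        ≤ ∑' _ : u k, ENNReal.ofReal ((2 * δ k) ^ m) *
          ENNReal.ofReal (4 ^ ((m : ℝ) - τ) / 2 ^ m * δ k ^ (-τ)) := ENNReal.tsum_le_tsum hterm
      _ ≤ ENNReal.ofReal (C * δ k ^ τ) *
          ENNReal.ofReal (4 ^ ((m : ℝ) - τ) / 2 ^ m * δ k ^ (-τ)) := by
          rw [ENNReal.tsum_mul_right]
          gcongr
      _ = ENNReal.ofReal (C * (4 ^ ((m : ℝ) - τ) / 2 ^ m)) := by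
          rw [← ENNReal.ofReal_mul (by positivity)]
          congr 1
          have : δ k ^ τ * δ k ^ (-τ) = 1 := by rw [← Real.rpow_add hδ', add_neg_cancel, Real.rpow_zero]
          linear_combination (C * (4 ^ ((m : ℝ) - τ) / 2 ^ m)) * this
  refine dimH_le_of_hausdorffMeasure_ne_top (d := (m - τ).toNNReal) ?_
  rw [Real.coe_toNNReal _ hd]
  refine ne_top_of_le_ne_top (b := ENNReal.ofReal (C * (4 ^ ((m : ℝ) - τ) / 2 ^ m)))
    ENNReal.ofReal_ne_top (hmain.trans ?_)
  exact liminf_le_of_le (by isBoundedDefault) fun x hx => by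
    obtain ⟨k, hk⟩ := hx.exists
    exact hk.trans (hbound k)

/-! ### Quasinorms, good scales and the holes they produce -/

theorem rpow_one_div_le_quasinorm {k : ℕ} (w x : Fin k → ℝ) (i : Fin k) :
    |x i| ^ (1 / w i) ≤ quasinorm w x :=
  le_ciSup (f := fun i => |x i| ^ (1 / w i)) (Set.finite_range _).bddAbove i

theorem exists_quasinorm_eq {k : ℕ} [Nonempty (Fin k)] (w x : Fin k → ℝ) :
    ∃ i, |x i| ^ (1 / w i) = quasinorm w x :=
  exists_eq_ciSup_of_finite (f := fun i => |x i| ^ (1 / w i))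

theorem quasinorm_nonneg {k : ℕ} (w x : Fin k → ℝ) : 0 ≤ quasinorm w x :=
  Real.iSup_nonneg fun _ => Real.rpow_nonneg (abs_nonneg _) _

theorem intDist_le_quasinorm {k : ℕ} (w x : Fin k → ℝ) (p : Fin k → ℤ) :
    intDist w x ≤ quasinorm w (fun i => x i - (p i : ℝ)) :=
  ciInf_le (f := fun p : Fin k → ℤ => quasinorm w (fun i => x i - (p i : ℝ)))
    ⟨0, by rintro _ ⟨p, rfl⟩; exact quasinorm_nonneg _ _⟩ p

/-- The coordinatewise form of a lower bound for the quasinorm. -/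
theorem exists_rpow_le_of_le_quasinorm {k : ℕ} [Nonempty (Fin k)] {w x : Fin k → ℝ}
    (hw : ∀ i, 0 < w i) {R : ℝ} (hR : 0 ≤ R) (h : R ≤ quasinorm w x) : ∃ i, R ^ w i ≤ |x i| := by
  obtain ⟨i, hi⟩ := exists_quasinorm_eq w x
  refine ⟨i, ?_⟩
  have h1 := Real.rpow_le_rpow hR (h.trans_eq hi.symm) (hw i).le
  rwa [← Real.rpow_mul (abs_nonneg _), one_div_mul_cancel (hw i).ne', Real.rpow_one] at h1

/-- There is no integer vector of quasinorm below `X` with image within `η / X` of an integer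
vector. -/
def IsGoodScale {m n : ℕ} (r : Fin m → ℝ) (s : Fin n → ℝ) (A : Matrix (Fin m) (Fin n) ℝ)
    (η X : ℝ) : Prop :=
  ∀ q : Fin n → ℤ, 0 < quasinorm s (intVec q) → quasinorm s (intVec q) < X →
    η / X ≤ intDist r (A.mulVec (intVec q))

/-- At a good scale, the integer combinations of the columns of `A` are dense at that scale. -/
theorem exists_int_near_of_isGoodScale {m n : ℕ} {r : Fin m → ℝ} {s : Fin n → ℝ}
    (hr : ∀ i, 0 < r i) (hs : ∀ j, 0 < s j) (hr_sum : ∑ i, r i = 1) (hs_sum : ∑ j, s j = 1)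
    {A : Matrix (Fin m) (Fin n) ℝ} {η X : ℝ} (hη : 0 < η) (hη1 : η ≤ 1) (hX : 1 ≤ X)
    (hgood : IsGoodScale r s A η X) {K : ℕ} (hK : 1 < K * η ^ (m + n))
    (b : Fin m → ℝ) (t : Fin n → ℝ) :
    ∃ (p : Fin m → ℤ) (q : Fin n → ℤ),
      (∀ i, |A.mulVec (intVec q) i + p i - b i| ≤ K * η / X ^ r i) ∧
      ∀ j, |(q j : ℝ) - t j| ≤ K * η * X ^ s j := by
  have hX0 : 0 < X := one_pos.trans_le hX
  have : Nonempty (Fin m) := by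
    by_contra h
    rw [not_nonempty_iff] at h
    simp at hr_sum
  have : Nonempty (Fin n) := by
    by_contra h
    rw [not_nonempty_iff] at h
    simp at hs_sum
  set D : Matrix (Fin m) (Fin m) ℝ := Matrix.diagonal fun i => X ^ r i with hD
  set D' : Matrix (Fin n) (Fin n) ℝ := Matrix.diagonal fun j => (X ^ s j)⁻¹ with hD'
  -- The determinant is one because both weights sum to one.
  set M := Matrix.fromBlocks D (D * A) 0 D' with hM
  have hdet : M.det = 1 := by
    rw [hM, Matrix.det_fromBlocks_zero₂₁, hD, hD', Matrix.det_diagonal, Matrix.det_diagonal,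
      Finset.prod_inv_distrib, ← Real.rpow_sum_of_pos hX0, ← Real.rpow_sum_of_pos hX0, hr_sum,
      hs_sum]
    exact mul_inv_cancel₀ (Real.rpow_pos_of_pos hX0 _).ne'
  have hmulV : ∀ z : Fin m ⊕ Fin n → ℤ, M.mulVec (fun i => (z i : ℝ)) =
      Sum.elim (fun i => X ^ r i * (A.mulVec (intVec fun j => z (Sum.inr j)) i + z (Sum.inl i)))
        (fun j => (X ^ s j)⁻¹ * z (Sum.inr j)) := by
    intro z
    rw [hM, Matrix.fromBlocks_mulVec]
    congr 1
    · ext i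
      rw [Pi.add_apply, ← Matrix.mulVec_mulVec, hD, Matrix.mulVec_diagonal, Matrix.mulVec_diagonal]
      exact (add_comm _ _).trans (mul_add _ _ _).symm
    · ext j
      rw [Matrix.zero_mulVec, zero_add, hD', Matrix.mulVec_diagonal]
      rfl
  have hshort : ∀ z : Fin m ⊕ Fin n → ℤ, z ≠ 0 → η ≤ ‖M.mulVec (fun i => (z i : ℝ))‖ := by
    intro z hz
    rw [hmulV]
    set q : Fin n → ℤ := fun j => z (Sum.inr j) with hq
    have hone : ∀ k : ℤ, k ≠ 0 → 1 ≤ |(k : ℝ)| := fun k hk => by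
      exact_mod_cast Int.one_le_abs hk
    -- If `q = 0`, an integer coordinate of `p` is expanded; if `q ≠ 0` is small, goodness bounds
    -- the upper block; otherwise the lower block is at least one.
    by_cases hq0 : q = 0
    · obtain ⟨i, hi⟩ : ∃ i, z (Sum.inl i) ≠ 0 := by
        by_contra h
        push Not at h
        exact hz (by ext (i | j); exacts [h i, congrFun hq0 j])
      refine le_trans ?_ (norm_le_pi_norm _ (Sum.inl i))
      rw [Sum.elim_inl, hq0]
      have h0 : intVec (0 : Fin n → ℤ) = 0 := by ext; simp [intVec]
      rw [h0, Matrix.mulVec_zero, Pi.zero_apply, zero_add, Real.norm_eq_abs, abs_mul,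
        abs_of_pos (Real.rpow_pos_of_pos hX0 _)]
      nlinarith [hone _ hi, Real.one_le_rpow hX (hr i).le]
    · by_cases hqX : quasinorm s (intVec q) < X
      · have hpos : 0 < quasinorm s (intVec q) := by
          obtain ⟨j, hj⟩ := Function.ne_iff.1 hq0
          refine lt_of_lt_of_le ?_ (rpow_one_div_le_quasinorm s (intVec q) j)
          exact Real.rpow_pos_of_pos (one_pos.trans_le (hone _ hj)) _
        have h1 := (hgood q hpos hqX).trans
          (intDist_le_quasinorm r _ fun i => -z (Sum.inl i))
        obtain ⟨i, hi⟩ := exists_rpow_le_of_le_quasinorm hr (by positivity) h1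
        refine le_trans ?_ (norm_le_pi_norm _ (Sum.inl i))
        rw [Sum.elim_inl, Real.norm_eq_abs, abs_mul, abs_of_pos (Real.rpow_pos_of_pos hX0 _)]
        rw [Real.div_rpow hη.le hX0.le, div_le_iff₀ (Real.rpow_pos_of_pos hX0 _)] at hi
        have hri : r i ≤ 1 := hr_sum ▸ Finset.single_le_sum (fun i _ => (hr i).le)
          (Finset.mem_univ i)
        have h2 := Real.rpow_le_rpow_of_exponent_ge hη hη1 hri
        rw [Real.rpow_one] at h2
        push_cast at hi
        rw [sub_neg_eq_add] at hi
        linarith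
      · obtain ⟨j, hj⟩ := exists_rpow_le_of_le_quasinorm hs hX0.le (not_lt.1 hqX)
        refine le_trans ?_ (norm_le_pi_norm _ (Sum.inr j))
        rw [Sum.elim_inr, Real.norm_eq_abs, abs_mul,
          abs_of_pos (inv_pos.2 (Real.rpow_pos_of_pos hX0 _)), ← div_eq_inv_mul]
        exact hη1.trans ((one_le_div (Real.rpow_pos_of_pos hX0 _)).2 hj)
  obtain ⟨z, hz⟩ := exists_int_near M hdet hη hshort K (by simpa using hK)
    (Sum.elim (fun i => X ^ r i * b i) fun j => (X ^ s j)⁻¹ * t j)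
  rw [hmulV, pi_norm_le_iff_of_nonneg (by positivity)] at hz
  refine ⟨fun i => z (Sum.inl i), fun j => z (Sum.inr j), fun i => ?_, fun j => ?_⟩
  · have h1 := hz (Sum.inl i)
    have hp : 0 < X ^ r i := Real.rpow_pos_of_pos hX0 _
    rw [Pi.sub_apply, Sum.elim_inl, Sum.elim_inl, ← mul_sub, Real.norm_eq_abs, abs_mul,
      abs_of_pos hp, abs_sub_comm] at h1
    rw [le_div_iff₀ hp]
    linarith
  · have h1 := hz (Sum.inr j)
    have hp : 0 < X ^ s j := Real.rpow_pos_of_pos hX0 _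
    rw [Pi.sub_apply, Sum.elim_inr, Sum.elim_inr, ← mul_sub, Real.norm_eq_abs, abs_mul,
      abs_of_pos (inv_pos.2 hp), abs_sub_comm, ← div_eq_inv_mul, div_le_iff₀ hp] at h1
    exact h1

/-- At a good scale, near each point of a set of `ε`-bad targets there is a hole in that set. -/
theorem exists_hole_of_isGoodScale {m n : ℕ} {r : Fin m → ℝ} {s : Fin n → ℝ}
    (hr : ∀ i, 0 < r i) (hs : ∀ j, 0 < s j) (hr_sum : ∑ i, r i = 1) (hs_sum : ∑ j, s j = 1)
    {A : Matrix (Fin m) (Fin n) ℝ} {η X : ℝ} (hη : 0 < η) (hη1 : η ≤ 1) (hX : 1 ≤ X)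
    (hgood : IsGoodScale r s A η X) {K : ℕ} (hK : 1 < K * η ^ (m + n)) (hK1 : 1 ≤ K * η)
    {C : ℝ} (hC : 0 < C) (hCs : ∀ j, (3 * (K * η)) ^ (1 / s j) ≤ C) {ε T : ℝ} (hε : 0 < ε)
    (hT : T ≤ X) {E : Set (Fin m → ℝ)}
    (hE : ∀ b ∈ E, ∀ q : Fin n → ℤ, T ≤ quasinorm s (intVec q) →
      ε < quasinorm s (intVec q) * intDist r (A.mulVec (intVec q) - b)) (b : Fin m → ℝ) :
    ∃ x : Fin m → ℝ, (∀ i, |x i - b i| ≤ K * η / X ^ r i) ∧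
      ∀ e ∈ E, ∃ i, (ε / C / X) ^ r i ≤ |e i - x i| := by
  have hX0 : 0 < X := one_pos.trans_le hX
  have : Nonempty (Fin m) := by
    by_contra h
    rw [not_nonempty_iff] at h
    simp at hr_sum
  have : Nonempty (Fin n) := by
    by_contra h
    rw [not_nonempty_iff] at h
    simp at hs_sum
  -- The centre `2R * X^s` puts each `q j` between `R * X^s` and `3R * X^s`; as `R ≥ 1`, this gives
  -- `X ≤ ‖q‖_s ≤ C * X`.
  obtain ⟨p, q, hp, hq⟩ := exists_int_near_of_isGoodScale hr hs hr_sum hs_sum hη hη1 hX hgood hK b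
    (fun j => 2 * (K * η) * X ^ s j)
  set R : ℝ := K * η with hR
  have hXs : ∀ j, 0 < X ^ s j := fun j => Real.rpow_pos_of_pos hX0 _
  have hqlow : ∀ j, X ^ s j ≤ q j := by
    intro j
    have h1 := (abs_le.1 (hq j)).1
    nlinarith [hXs j]
  have hqup : ∀ j, (q j : ℝ) ≤ 3 * R * X ^ s j := by
    intro j
    have h1 := (abs_le.1 (hq j)).2
    linarith
  have hqpos : ∀ j, 0 < (q j : ℝ) := fun j => (hXs j).trans_le (hqlow j)
  have hXinv : ∀ j, (X ^ s j) ^ (1 / s j) = X := fun j => by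
    rw [← Real.rpow_mul hX0.le, mul_one_div_cancel (hs j).ne', Real.rpow_one]
  have hnlow : X ≤ quasinorm s (intVec q) := by
    obtain ⟨j⟩ := ‹Nonempty (Fin n)›
    refine le_trans ?_ (rpow_one_div_le_quasinorm s (intVec q) j)
    rw [intVec, abs_of_pos (hqpos j)]
    have := Real.rpow_le_rpow (hXs j).le (hqlow j) (one_div_pos.2 (hs j)).le
    rwa [hXinv] at this
  have hnup : quasinorm s (intVec q) ≤ C * X := by
    obtain ⟨j, hj⟩ := exists_quasinorm_eq s (intVec q)
    rw [← hj, intVec, abs_of_pos (hqpos j)]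
    have := Real.rpow_le_rpow (hqpos j).le (hqup j) (one_div_pos.2 (hs j)).le
    rw [Real.mul_rpow (by positivity) (hXs j).le, hXinv] at this
    exact this.trans (mul_le_mul_of_nonneg_right (hCs j) hX0.le)
  refine ⟨fun i => A.mulVec (intVec q) i + p i, hp, fun e he => ?_⟩
  have h1 := hE e he q (hT.trans hnlow)
  have h2 := intDist_le_quasinorm r (A.mulVec (intVec q) - e) (fun i => -p i)
  have h3 : ε / C / X ≤
      quasinorm r (fun i => (A.mulVec (intVec q) - e) i - ((-p i : ℤ) : ℝ)) := by
    rw [div_div, div_le_iff₀ (by positivity)]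
    have h4 := mul_le_mul hnup h2 (Real.iInf_nonneg fun p => quasinorm_nonneg _ _) (by positivity)
    linarith
  obtain ⟨i, hi⟩ := exists_rpow_le_of_le_quasinorm hr (by positivity) h3
  refine ⟨i, hi.trans (le_of_eq ?_)⟩
  rw [abs_sub_comm]
  congr 1
  simp only [Pi.sub_apply]
  push_cast
  ring

/-! ### Volume decay across scales -/

open MeasureTheory in
/-- Passing a good scale decreases the volume of the neighbourhoods of a set of bad targets. -/
theorem volume_boxNhd_decay {m : ℕ} {r : Fin m → ℝ}
    (hr : ∀ i, 0 < r i) (hr_sum : ∑ i, r i = 1) {R κ X Y : ℝ} (hR : 0 ≤ R) (hκ : 0 < κ)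
    (hκ1 : κ ≤ 1) (hX : 0 < X) (hXY : ∀ i, 2 * (R + 1) ≤ (κ * (Y / X)) ^ r i) (hY : 0 < Y)
    {E : Set (Fin m → ℝ)}
    (hole : ∀ b ∈ E, ∃ x : Fin m → ℝ, (∀ i, |x i - b i| ≤ R / X ^ r i) ∧
      ∀ e ∈ E, ∃ i, (κ / X) ^ r i ≤ |e i - x i|) :
    volume (boxNhd E fun i => (R + 1) / Y ^ r i) *
      (1 + ENNReal.ofReal (κ / (6 * (R + 1)) ^ m)) ≤ volume (boxNhd E fun i => (R + 1) / X ^ r i) := by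
  have hXr : ∀ i, 0 < X ^ r i := fun i => Real.rpow_pos_of_pos hX _
  have hYr : ∀ i, 0 < Y ^ r i := fun i => Real.rpow_pos_of_pos hY _
  have hκr : ∀ i, 0 < κ ^ r i := fun i => Real.rpow_pos_of_pos hκ _
  have hκr1 : ∀ i, κ ^ r i ≤ 1 := fun i => Real.rpow_le_one hκ.le hκ1 (hr i).le
  have hdiv : ∀ i, (κ / X) ^ r i = κ ^ r i / X ^ r i := fun i => Real.div_rpow hκ.le hX.le _
  -- The half is there because holes must be empty to twice their half-side; the `+ 1` in `R + 1`
  -- makes room for the hole inside the big box.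
  have hstep := volume_boxNhd_of_holes E (a := fun i => (R + 1) / X ^ r i)
    (h := fun i => (κ / X) ^ r i / 2) (fun i => by positivity)
    (fun i => by
      rw [hdiv, div_div, div_le_div_iff₀ (by have := hXr i; positivity) (hXr i)]
      nlinarith [hXr i, hκr1 i])
    (fun b hb => by
      obtain ⟨x, hx, hxE⟩ := hole b hb
      refine ⟨x, fun i => ?_, fun e he => ?_⟩
      · refine (add_le_add_left (hx i) _).trans ?_
        rw [hdiv, div_right_comm, ← add_div]
        have := hκr1 i
        gcongr
        linarith
      · obtain ⟨i, hi⟩ := hxE e he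
        exact ⟨i, by linarith⟩)
  have hprod : ∏ i, ((κ / X) ^ r i / 2 / (3 * ((R + 1) / X ^ r i))) = κ / (6 * (R + 1)) ^ m := by
    have : ∀ i, (κ / X) ^ r i / 2 / (3 * ((R + 1) / X ^ r i)) = κ ^ r i / (6 * (R + 1)) := by
      intro i
      rw [hdiv]
      have := (hXr i).ne'
      field_simp
      norm_num
    rw [Finset.prod_congr rfl fun i _ => this i, Finset.prod_div_distrib,
      ← Real.rpow_sum_of_pos hκ, hr_sum]
    simp
  rw [hprod] at hstep
  refine le_trans ?_ hstep
  gcongr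
  -- By `hXY`, boxes at scale `Y` fit inside boxes of the hole's size.
  refine boxNhd_mono E fun i => ?_
  have h1 := hXY i
  rw [Real.mul_rpow hκ.le (by positivity), Real.div_rpow hY.le hX.le] at h1
  rw [hdiv, div_div, div_le_div_iff₀ (hYr i) (by have := hXr i; positivity)]
  rw [mul_div_assoc', le_div_iff₀ (hXr i)] at h1
  linarith

/-- A sequence that drops by a factor `θ` over `G` steps from each index satisfying `P`. -/
theorem pow_card_mul_pow_le {v : ℕ → ℝ} (hv : ∀ l, 0 ≤ v l) (hanti : Antitone v) {θ : ℝ}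
    (hθ : 1 ≤ θ) {G l₀ : ℕ} (hG : 0 < G) (P : ℕ → Prop) [DecidablePred P]
    (hP : ∀ l, l₀ ≤ l → P l → θ * v (l + G) ≤ v l) (N : ℕ) (hN : l₀ ≤ N) :
    θ ^ ((Finset.Ico l₀ N).filter P).card * v (N + G) ^ G ≤ v l₀ ^ G := by
  -- Advancing the window of `G` factors by one replaces `v N` by `v (N + G)`, which gains `θ`
  -- exactly where `P N` lets it.
  have key : θ ^ ((Finset.Ico l₀ N).filter P).card * ∏ j ∈ Finset.range G, v (N + j)
      ≤ ∏ j ∈ Finset.range G, v (l₀ + j) := by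
    induction N, hN using Nat.le_induction with
    | base => simp
    | succ N hN ih =>
      have hrec : (∏ j ∈ Finset.range G, v (N + 1 + j)) * v N
          = (∏ j ∈ Finset.range G, v (N + j)) * v (N + G) := by
        rw [← Finset.prod_range_succ, Finset.prod_range_succ', add_zero]
        congr 1
        exact Finset.prod_congr rfl fun j _ => by rw [add_right_comm, add_assoc]
      have hnn : 0 ≤ ∏ j ∈ Finset.range G, v (N + 1 + j) := Finset.prod_nonneg fun j _ => hv _
      have hnn' : 0 ≤ ∏ j ∈ Finset.range G, v (N + j) := Finset.prod_nonneg fun j _ => hv _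
      rcases (hv N).eq_or_lt with h0 | hpos
      · have hz : ∏ j ∈ Finset.range G, v (N + 1 + j) = 0 :=
          Finset.prod_eq_zero (Finset.mem_range.2 hG)
            (le_antisymm ((hanti (by omega)).trans h0.ge) (hv _))
        rw [hz, mul_zero]
        exact Finset.prod_nonneg fun j _ => hv _
      · refine le_trans ?_ ih
        by_cases hPN : P N
        · have hcard : ((Finset.Ico l₀ (N + 1)).filter P).card
              = ((Finset.Ico l₀ N).filter P).card + 1 := by
            rw [← Finset.insert_Ico_right_eq_Ico_add_one hN, Finset.filter_insert, if_pos hPN,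
              Finset.card_insert_of_notMem (by simp)]
          rw [hcard, pow_succ, mul_assoc]
          refine mul_le_mul_of_nonneg_left ?_ (by positivity)
          refine le_of_mul_le_mul_right ?_ hpos
          rw [mul_assoc, hrec]
          nlinarith [hP N hN hPN]
        · have hcard : ((Finset.Ico l₀ (N + 1)).filter P).card
              = ((Finset.Ico l₀ N).filter P).card := by
            rw [← Finset.insert_Ico_right_eq_Ico_add_one hN, Finset.filter_insert, if_neg hPN]
          rw [hcard]
          refine mul_le_mul_of_nonneg_left ?_ (by positivity)
          exact Finset.prod_le_prod (fun j _ => hv _) fun j _ => hanti (by omega)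
  calc θ ^ ((Finset.Ico l₀ N).filter P).card * v (N + G) ^ G
      ≤ θ ^ ((Finset.Ico l₀ N).filter P).card * ∏ j ∈ Finset.range G, v (N + j) := by
        refine mul_le_mul_of_nonneg_left ?_ (by positivity)
        rw [← Finset.card_range G, ← Finset.prod_const, Finset.card_range]
        exact Finset.prod_le_prod (fun j _ => hv _) fun j hj =>
          hanti (by have := Finset.mem_range.1 hj; omega)
    _ ≤ _ := key
    _ ≤ v l₀ ^ G := by
        conv_rhs => rw [← Finset.card_range G, ← Finset.prod_const]
        exact Finset.prod_le_prod (fun j _ => hv _) fun j _ => hanti (by omega)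

/-! ### Density of good scales -/

open scoped Classical in
/-- If `A` is not singular on average, then good scales have positive upper density. -/
theorem exists_frequent_isGoodScale {m n : ℕ} {r : Fin m → ℝ} {s : Fin n → ℝ}
    {A : Matrix (Fin m) (Fin n) ℝ} (hA : ¬ SingularOnAverage r s A) :
    ∃ η δ : ℝ, 0 < η ∧ η ≤ 1 ∧ 0 < δ ∧ ∀ N₀ : ℕ, ∃ N ≥ N₀,
      δ * N ≤ ((Finset.Icc 1 N).filter fun l : ℕ => IsGoodScale r s A η (2 ^ l)).card := by
  unfold SingularOnAverage at hA
  push Not at hA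
  obtain ⟨η, hη, hnt⟩ := hA
  rw [Metric.tendsto_atTop] at hnt
  push Not at hnt
  obtain ⟨δ, hδ, hN⟩ := hnt
  -- Lowering `η` keeps scales good, and `η ≤ 1` is needed later for `η ≤ η ^ r i`.
  refine ⟨min η 1, δ, by positivity, min_le_right _ _, hδ, fun N₀ => ?_⟩
  obtain ⟨N, hNN, hd⟩ := hN (N₀ + 1)
  refine ⟨N, by omega, ?_⟩
  have hN0 : (0 : ℝ) < N := by exact_mod_cast (show 0 < N by omega)
  set Q : ℕ → Prop := fun l => ∃ q : Fin n → ℤ,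
    intDist r (A.mulVec (intVec q)) < η * (2 : ℝ) ^ (-(l : ℤ)) ∧
      0 < quasinorm s (intVec q) ∧ quasinorm s (intVec q) < (2 : ℝ) ^ l with hQ
  have hset : {l : ℕ | l ∈ Set.Icc 1 N ∧ Q l} = ((Finset.Icc 1 N).filter Q : Finset ℕ) := by
    ext l
    simp
  change δ ≤ dist ((({l : ℕ | l ∈ Set.Icc 1 N ∧ Q l}.ncard : ℕ) : ℝ) / N) 1 at hd
  rw [hset, Set.ncard_coe_finset] at hd
  have hsum := Finset.card_filter_add_card_filter_not (s := Finset.Icc 1 N) Q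
  rw [Nat.card_Icc, Nat.add_sub_cancel] at hsum
  have hsumR : (((Finset.Icc 1 N).filter Q).card : ℝ)
      + ((Finset.Icc 1 N).filter fun l => ¬ Q l).card = N := by exact_mod_cast hsum
  have hsub : ((Finset.Icc 1 N).filter fun l => ¬ Q l).card
      ≤ ((Finset.Icc 1 N).filter fun l : ℕ => IsGoodScale r s A (min η 1) (2 ^ l)).card := by
    refine Finset.card_le_card (Finset.monotone_filter_right _ fun l _ hl q hq0 hq1 => ?_)
    by_contra hlt
    refine hl ⟨q, lt_of_lt_of_le (not_le.1 hlt) ?_, hq0, hq1⟩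
    rw [zpow_neg, zpow_natCast, ← div_eq_mul_inv]
    gcongr
    exact min_le_left _ _
  have hsubR : (((Finset.Icc 1 N).filter fun l => ¬ Q l).card : ℝ)
      ≤ ((Finset.Icc 1 N).filter fun l : ℕ => IsGoodScale r s A (min η 1) (2 ^ l)).card := by
    exact_mod_cast hsub
  refine le_trans ?_ hsubR
  have hx : (((Finset.Icc 1 N).filter Q).card : ℝ) / N - 1
      = -((((Finset.Icc 1 N).filter fun l => ¬ Q l).card : ℝ) / N) := by
    field_simp
    linarith
  rw [Real.dist_eq, hx, abs_neg, abs_of_nonneg (by positivity), le_div_iff₀ hN0] at hd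
  exact hd

/-! ### Frequent holes lower the dimension -/

open MeasureTheory in
theorem volume_boxNhd_ne_top {m : ℕ} {E : Set (Fin m → ℝ)} (hE : Bornology.IsBounded E)
    (a : Fin m → ℝ) : volume (boxNhd E a) ≠ ⊤ := by
  obtain ⟨R, hR⟩ := hE.subset_closedBall 0
  have hsub : boxNhd E a ⊆ box 0 (fun i => |R| + |a i| + 1) := by
    intro y hy i
    obtain ⟨b, hb, hy⟩ := mem_boxNhd.1 hy
    have h1 : ‖b‖ ≤ R := by simpa using hR hb
    have h2 : |b i| ≤ R := (norm_le_pi_norm b i).trans h1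
    have h3 := abs_sub_le (y i) (b i) 0
    have h4 := hy i
    simp only [Pi.zero_apply, sub_zero] at h3 ⊢
    linarith [le_abs_self R, le_abs_self (a i)]
  refine ne_top_of_le_ne_top ?_ (measure_mono hsub)
  rw [volume_box _ _ fun i => by positivity]
  exact ENNReal.ofReal_ne_top

open MeasureTheory in
/-- Holes at frequently many scales force a drop of the Hausdorff dimension. -/
theorem dimH_le_of_frequent_holes {m : ℕ} {r : Fin m → ℝ} (hr : ∀ i, 0 < r i)
    (hr_sum : ∑ i, r i = 1) {R κ δ τ : ℝ} (hR : 0 ≤ R) (hκ : 0 < κ) (hκ1 : κ ≤ 1)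
    {G l₀ : ℕ} (hG : 0 < G) (hGκ : ∀ i, 2 * (R + 1) ≤ (κ * 2 ^ G) ^ r i)
    (P : ℕ → Prop) [DecidablePred P]
    (hfreq : ∀ N₀ : ℕ, ∃ N ≥ N₀, δ * N ≤ ((Finset.Icc 1 N).filter P).card)
    {E : Set (Fin m → ℝ)} (hE : Bornology.IsBounded E)
    (hole : ∀ l, l₀ ≤ l → P l → ∀ b ∈ E, ∃ x : Fin m → ℝ,
      (∀ i, |x i - b i| ≤ R / ((2 : ℝ) ^ l) ^ r i) ∧
      ∀ e ∈ E, ∃ i, (κ / 2 ^ l) ^ r i ≤ |e i - x i|)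
    (hτm : τ ≤ m) (hτ : τ * G * Real.log 2 ≤ δ * Real.log (1 + κ / (6 * (R + 1)) ^ m)) :
    dimH E ≤ ENNReal.ofReal (m - τ) := by
  set θ : ℝ := 1 + κ / (6 * (R + 1)) ^ m with hθ
  have hθ1 : 1 ≤ θ := by
    have : 0 < κ / (6 * (R + 1)) ^ m := by positivity
    linarith
  have hθ0 : 0 < θ := one_pos.trans_le hθ1
  have hlog : 0 ≤ Real.log θ := Real.log_nonneg hθ1
  set v : ℕ → ℝ := fun l => volume.real (boxNhd E fun i => (R + 1) / ((2 : ℝ) ^ l) ^ r i) with hv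
  have hv0 : ∀ l, 0 ≤ v l := fun l => measureReal_nonneg
  have hanti : Antitone v := by
    intro k l hkl
    refine measureReal_mono (boxNhd_mono E fun i => ?_) (volume_boxNhd_ne_top hE _)
    have : (2 : ℝ) ^ k ≤ 2 ^ l := pow_le_pow_right₀ one_le_two hkl
    have := Real.rpow_le_rpow (by positivity) this (hr i).le
    gcongr
  have hdrop : ∀ l, l₀ ≤ l → P l → θ * v (l + G) ≤ v l := by
    intro l hl hPl
    have h1 := volume_boxNhd_decay hr hr_sum (Y := 2 ^ (l + G)) hR hκ hκ1
      (pow_pos two_pos l) (fun i => by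
        rw [pow_add, mul_div_cancel_left₀ _ (by positivity)]
        exact hGκ i) (by positivity) (hole l hl hPl)
    have h2 := ENNReal.toReal_mono (volume_boxNhd_ne_top hE _) h1
    rw [ENNReal.toReal_mul, ← ENNReal.ofReal_one, ← ENNReal.ofReal_add zero_le_one (by positivity),
      ENNReal.toReal_ofReal (by positivity)] at h2
    rw [mul_comm]
    exact h2
  have hGpos : (0 : ℝ) < G := by exact_mod_cast hG
  -- The constant absorbs the volume at `l₀`, the at most `l₀ + 1` good indices lost in passing to
  -- `Ico l₀ N`, and the shift from `N` to `N + G`.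
  refine dimH_le_of_frequently_volume_le E
    (C := v l₀ * θ ^ (((l₀ : ℝ) + 1) / G) * 2 ^ (τ * G)) (by have := hv0 l₀; positivity) hτm
    fun δ₀ hδ₀ => ?_
  obtain ⟨N₁, hN₁⟩ := exists_pow_lt_of_lt_one hδ₀ (show (1 / 2 : ℝ) < 1 by norm_num)
  obtain ⟨N, hN, hcount⟩ := hfreq (max N₁ l₀)
  have hNl : l₀ ≤ N := (le_max_right _ _).trans hN
  refine ⟨(1 / 2) ^ (N + G), by positivity, lt_of_le_of_lt (pow_le_pow_of_le_one (by norm_num)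
    (by norm_num) (by have := (le_max_left _ _).trans hN; omega)) hN₁, ?_⟩
  set c : ℕ := ((Finset.Ico l₀ N).filter P).card with hc
  have hcN : δ * N ≤ c + (l₀ + 1) := by
    refine hcount.trans ?_
    have hsub : (Finset.Icc 1 N).filter P ⊆
        ((Finset.Ico l₀ N).filter P) ∪ (Finset.range l₀ ∪ {N}) := by
      intro l hl
      simp only [Finset.mem_filter, Finset.mem_Icc, Finset.mem_union, Finset.mem_Ico,
        Finset.mem_range, Finset.mem_singleton] at hl ⊢
      rcases lt_or_ge l l₀ with h | h
      · exact Or.inr (Or.inl h)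
      · rcases hl.1.2.lt_or_eq with h' | h'
        · exact Or.inl ⟨⟨h, h'⟩, hl.2⟩
        · exact Or.inr (Or.inr h')
    have h1 := (Finset.card_le_card hsub).trans (Finset.card_union_le _ _)
    have h2 := Finset.card_union_le (Finset.range l₀) {N}
    rw [Finset.card_range, Finset.card_singleton] at h2
    exact_mod_cast h1.trans (Nat.add_le_add_left h2 _)
  have hpow := pow_card_mul_pow_le hv0 hanti hθ1 hG P hdrop N hNl
  have hvN : v (N + G) ≤ v l₀ * θ ^ (-(c : ℝ) / G) := by
    have hnn : 0 ≤ v l₀ * θ ^ (-(c : ℝ) / G) := mul_nonneg (hv0 _) (by positivity)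
    refine (pow_le_pow_iff_left₀ (hv0 _) hnn hG.ne').1 ?_
    rw [mul_pow, ← Real.rpow_mul_natCast hθ0.le, div_mul_cancel₀ _ hGpos.ne', Real.rpow_neg hθ0.le,
      Real.rpow_natCast, ← div_eq_mul_inv, le_div_iff₀ (by positivity), mul_comm]
    exact hpow
  have hexp : θ ^ (-(c : ℝ) / G) ≤
      θ ^ (((l₀ : ℝ) + 1) / G) * (2 ^ (τ * G) * ((1 / 2 : ℝ) ^ (N + G)) ^ τ) := by
    have h2 : ((1 / 2 : ℝ) ^ (N + G)) ^ τ = 2 ^ (-(((N : ℝ) + G) * τ)) := by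
      rw [one_div, inv_pow, Real.inv_rpow (by positivity), ← Real.rpow_natCast_mul two_pos.le,
        Real.rpow_neg two_pos.le]
      push_cast
      rfl
    rw [h2, ← Real.rpow_add two_pos, Real.rpow_def_of_pos hθ0, Real.rpow_def_of_pos hθ0,
      Real.rpow_def_of_pos two_pos, ← Real.exp_add, Real.exp_le_exp]
    have h3 : τ * G * Real.log 2 * N ≤ (c + (l₀ + 1)) * Real.log θ := by
      have := mul_le_mul_of_nonneg_right hτ (Nat.cast_nonneg (α := ℝ) N)
      have := mul_le_mul_of_nonneg_right hcN hlog
      linarith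
    have h4 : τ * Real.log 2 * N ≤ (c + (l₀ + 1)) * Real.log θ / G := by
      rw [le_div_iff₀ hGpos]
      linarith
    have h5 : Real.log θ * (-(c : ℝ) / G) =
      Real.log θ * (((l₀ : ℝ) + 1) / G) - (c + (l₀ + 1)) * Real.log θ / G := by ring
    rw [h5]
    linarith
  -- Since `r i ≤ 1`, the cube of half-side `2^(-(N + G))` lies in the weighted box.
  have hle : volume (boxNhd E fun _ => (1 / 2 : ℝ) ^ (N + G)) ≤ ENNReal.ofReal (v (N + G)) := by
    rw [hv, ofReal_measureReal (volume_boxNhd_ne_top hE _)]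
    refine measure_mono (boxNhd_mono E fun i => ?_)
    rw [one_div, inv_pow, inv_eq_one_div]
    have hri : r i ≤ 1 := hr_sum ▸ Finset.single_le_sum (fun i _ => (hr i).le) (Finset.mem_univ i)
    have h1 : (1 : ℝ) ≤ 2 ^ (N + G) := one_le_pow₀ one_le_two
    have h2 := Real.rpow_le_rpow_of_exponent_le h1 hri
    rw [Real.rpow_one] at h2
    gcongr
    linarith
  refine hle.trans (ENNReal.ofReal_le_ofReal (hvN.trans ?_))
  have := mul_le_mul_of_nonneg_left hexp (hv0 l₀)
  linarith

/-! ### Bad targets and choice of constants -/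

/-- The bad targets are a countable union of bounded sets on which the defining inequality holds
uniformly in `q`. -/
theorem badTargets_subset_iUnion {m n : ℕ} (r : Fin m → ℝ) (s : Fin n → ℝ)
    (A : Matrix (Fin m) (Fin n) ℝ) {ε ε' : ℝ} (hε : ε' < ε) :
    BadTargets r s A ε ⊆ ⋃ T : ℕ, {b | b ∈ Metric.closedBall 0 (T : ℝ) ∧
      ∀ q : Fin n → ℤ, (T : ℝ) ≤ quasinorm s (intVec q) →
        ε' < quasinorm s (intVec q) * intDist r (A.mulVec (intVec q) - b)} := by
  intro b hb
  have hb' : (ε' : EReal) < liminf (fun q : Fin n → ℤ =>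
      ((quasinorm s (intVec q) * intDist r (A.mulVec (intVec q) - b) : ℝ) : EReal))
      (comap (fun q : Fin n → ℤ => quasinorm s (intVec q)) atTop) :=
    lt_of_lt_of_le (EReal.coe_lt_coe_iff.2 hε) hb
  have hev := eventually_lt_of_lt_liminf hb'
  rw [eventually_comap, eventually_atTop] at hev
  obtain ⟨T, hT⟩ := hev
  obtain ⟨k, hk⟩ := exists_nat_ge (max T ‖b‖)
  refine Set.mem_iUnion.2 ⟨k, ?_, fun q hq => ?_⟩
  · simpa using (le_max_right _ _).trans hk
  · exact EReal.coe_lt_coe_iff.1 (hT _ (((le_max_left _ _).trans hk).trans hq) q rfl)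

theorem theorem1p2 {m n : ℕ} (r : Fin m → ℝ) (s : Fin n → ℝ)
    (hr : ∀ i, 0 < r i) (hs : ∀ j, 0 < s j) (hr_anti : Antitone r) (hs_anti : Antitone s)
    (hr_sum : ∑ i, r i = 1) (hs_sum : ∑ j, s j = 1)
    (A : Matrix (Fin m) (Fin n) ℝ) (hA : ¬ SingularOnAverage r s A) :
    ∀ ε₀ : ℝ, ε₀ < 1 → ∃ c : ℝ, 0 < c ∧ ∀ ε : ℝ, 0 < ε → ε ≤ ε₀ →
      ((dimH (BadTargets r s A ε) : ENNReal) : EReal) ≤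
        (((m : ℝ) - c * (ε / Real.log (1 / ε)) : ℝ) : EReal) := by
  classical
  intro ε₀ hε₀
  rcases le_or_gt ε₀ 0 with hneg | hε₀pos
  · exact ⟨1, one_pos, fun ε h1 h2 => absurd (h1.trans_le h2) (not_lt.2 hneg)⟩
  have hm : 1 ≤ m := by
    rcases Nat.eq_zero_or_pos m with rfl | h
    · simp at hr_sum
    · exact h
  obtain ⟨η, δ, hη, hη1, hδ, hfreq⟩ := exists_frequent_isGoodScale hA
  obtain ⟨K, hK⟩ := exists_nat_gt (max (1 / η ^ (m + n)) (1 / η))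
  have hK1 : 1 < K * η ^ (m + n) :=
    (div_lt_iff₀ (by positivity)).1 ((le_max_left _ _).trans_lt hK)
  have hK2 : 1 < K * η := (div_lt_iff₀ hη).1 ((le_max_right _ _).trans_lt hK)
  set R : ℝ := K * η with hRdef
  obtain ⟨C, hC1, hCs⟩ : ∃ C : ℝ, 1 ≤ C ∧ ∀ j, (3 * R) ^ (1 / s j) ≤ C := by
    obtain ⟨C, hC⟩ := (Set.finite_range fun j => (3 * R) ^ (1 / s j)).bddAbove
    exact ⟨max C 1, le_max_right _ _, fun j => (hC ⟨j, rfl⟩).trans (le_max_left _ _)⟩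
  obtain ⟨Γ, hΓ1, hΓr⟩ : ∃ Γ : ℝ, 1 ≤ Γ ∧ ∀ i, (2 * (R + 1)) ^ (1 / r i) ≤ Γ := by
    obtain ⟨C, hC⟩ := (Set.finite_range fun i => (2 * (R + 1)) ^ (1 / r i)).bddAbove
    exact ⟨max C 1, le_max_right _ _, fun j => (hC ⟨j, rfl⟩).trans (le_max_left _ _)⟩
  set L₀ : ℝ := Real.log (1 / ε₀) with hL₀
  have hL₀pos : 0 < L₀ := Real.log_pos (by rwa [lt_div_iff₀ hε₀pos, one_mul])
  set c₁ : ℝ := 1 / (2 * C) / (6 * (R + 1)) ^ m with hc₁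
  have hC0 : 0 < C := one_pos.trans_le hC1
  have hR0 : 0 < R := one_pos.trans hK2
  have hc₁pos : 0 < c₁ := by positivity
  have hc₁le : c₁ ≤ 1 := by
    have h1 : (1 : ℝ) ≤ (6 * (R + 1)) ^ m := one_le_pow₀ (by linarith)
    rw [hc₁, div_div, div_le_one (by positivity)]
    nlinarith
  -- Chosen so that `G * log 2 ≤ B * L`: since `L ≥ L₀`, the additive constant is absorbed into a
  -- multiple of `L`.
  set B : ℝ := 1 + Real.log (2 * (2 * C * Γ)) / L₀ with hB
  have hlogpos : 0 ≤ Real.log (2 * (2 * C * Γ)) := Real.log_nonneg (by nlinarith)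
  have hBpos : 0 < B := by positivity
  -- The first entry makes `τ` small enough for the decay rate; the cap `L₀` forces `τ ≤ 1 ≤ m`, so
  -- `ENNReal.ofReal` does not truncate `m - τ`.
  refine ⟨min (δ * c₁ / (2 * B)) L₀, by positivity, fun ε hε hεε₀ => ?_⟩
  set c : ℝ := min (δ * c₁ / (2 * B)) L₀ with hc
  have hcpos : 0 < c := by positivity
  have hε1 : ε < 1 := hεε₀.trans_lt hε₀
  set L : ℝ := Real.log (1 / ε) with hL
  have hLL₀ : L₀ ≤ L := Real.log_le_log (by positivity) (by gcongr)
  have hLpos : 0 < L := hL₀pos.trans_le hLL₀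
  set τ : ℝ := c * (ε / L) with hτ
  have hτm : τ ≤ m := by
    have h1 : c ≤ L := (min_le_right _ _).trans hLL₀
    have h2 : τ ≤ 1 := by
      rw [hτ, mul_div_assoc', div_le_one hLpos]
      nlinarith
    exact h2.trans (by exact_mod_cast hm)
  -- The lower limit only guarantees the inequality with a smaller constant, here `ε / 2`; `C` comes
  -- from `‖q‖_s ≤ C * X`.
  set κ : ℝ := ε / 2 / C with hκ
  have hκpos : 0 < κ := by positivity
  have hκ1 : κ ≤ 1 := by
    rw [hκ, div_le_one hC0]
    linarith
  have hΓκ : 1 < Γ / κ := by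
    rw [lt_div_iff₀ hκpos, one_mul]
    refine lt_of_lt_of_le ?_ hΓ1
    rw [hκ, div_lt_one hC0]
    linarith
  set G : ℕ := ⌈Real.logb 2 (Γ / κ)⌉₊ with hGdef
  have hlogb : 0 < Real.logb 2 (Γ / κ) := Real.logb_pos one_lt_two hΓκ
  have hG : 0 < G := Nat.ceil_pos.2 hlogb
  have hGκ : ∀ i, 2 * (R + 1) ≤ (κ * 2 ^ G) ^ r i := by
    intro i
    have h1 : Γ / κ ≤ 2 ^ G := by
      rw [← Real.rpow_natCast, ← Real.logb_le_iff_le_rpow one_lt_two (one_pos.trans hΓκ)]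
      exact Nat.le_ceil _
    have h2 : Γ ≤ κ * 2 ^ G := by
      rw [div_le_iff₀ hκpos] at h1
      linarith
    have h3 := Real.rpow_le_rpow (by positivity) ((hΓr i).trans h2) (hr i).le
    rwa [← Real.rpow_mul (by positivity), one_div_mul_cancel (hr i).ne', Real.rpow_one] at h3
  have hlog2 : 0 < Real.log 2 := Real.log_pos one_lt_two
  have hGL : G * Real.log 2 ≤ B * L := by
    have h1 : (G : ℝ) ≤ Real.logb 2 (Γ / κ) + 1 := (Nat.ceil_lt_add_one hlogb.le).le
    have h2 : (Real.logb 2 (Γ / κ) + 1) * Real.log 2 = Real.log (2 * (2 * C * Γ)) + L := by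
      rw [add_mul, Real.logb, div_mul_cancel₀ _ hlog2.ne', one_mul,
        ← Real.log_mul (by positivity) two_ne_zero, hL, ← Real.log_mul (by positivity)
        (by positivity)]
      congr 1
      rw [hκ]
      field_simp
    have h3 : Real.log (2 * (2 * C * Γ)) ≤ Real.log (2 * (2 * C * Γ)) / L₀ * L := by
      rw [div_mul_eq_mul_div, le_div_iff₀ hL₀pos]
      gcongr
    have h4 := mul_le_mul_of_nonneg_right h1 hlog2.le
    rw [h2] at h4
    rw [hB]
    linarith
  have hκc : κ / (6 * (R + 1)) ^ m = c₁ * ε := by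
    rw [hκ, hc₁]
    field_simp
  have hτG : τ * G * Real.log 2 ≤ δ * Real.log (1 + κ / (6 * (R + 1)) ^ m) := by
    rw [hκc]
    have hy : 0 < c₁ * ε := by positivity
    have hy1 : c₁ * ε ≤ 1 := by nlinarith
    have h1 : c₁ * ε / 2 ≤ Real.log (1 + c₁ * ε) := by
      have h2 := Real.one_sub_inv_le_log_of_pos (show 0 < 1 + c₁ * ε by positivity)
      refine le_trans ?_ h2
      rw [← one_div, one_sub_div (by positivity), le_div_iff₀ (by positivity)]
      nlinarith
    calc τ * G * Real.log 2 = τ * (G * Real.log 2) := by ring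
      _ ≤ τ * (B * L) := by
          have : 0 ≤ τ := by positivity
          gcongr
      _ = c * ε * B := by
          rw [hτ]
          field_simp
      _ ≤ δ * c₁ / (2 * B) * ε * B := by
          have := min_le_left (δ * c₁ / (2 * B)) L₀
          gcongr
      _ = δ * (c₁ * ε / 2) := by field_simp
      _ ≤ _ := by gcongr
  have hdim : dimH (BadTargets r s A ε) ≤ ENNReal.ofReal (m - τ) := by
    refine (dimH_mono (badTargets_subset_iUnion r s A (half_lt_self hε))).trans ?_
    rw [dimH_iUnion]
    refine iSup_le fun T => ?_
    -- Starting at `l₀ = T` suffices, as `T < 2^T ≤ 2^l` puts the scale beyond the threshold.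
    refine dimH_le_of_frequent_holes (l₀ := T) hr hr_sum hR0.le hκpos hκ1 hG hGκ
      (fun l => IsGoodScale r s A η (2 ^ l)) hfreq
      (Metric.isBounded_closedBall.subset fun b hb => hb.1) (fun l hl hgood b _ => ?_) hτm hτG
    refine exists_hole_of_isGoodScale hr hs hr_sum hs_sum hη hη1 (one_le_pow₀ one_le_two) hgood
      hK1 hK2.le hC0 hCs (half_pos hε) (T := T) ?_ (fun e he => he.2) b
    have h1 : T < 2 ^ T := Nat.lt_two_pow_self
    exact_mod_cast h1.le.trans (Nat.pow_le_pow_right two_pos hl)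
  refine (EReal.coe_ennreal_le_coe_ennreal_iff.2 hdim).trans (le_of_eq ?_)
  rw [EReal.coe_ennreal_ofReal, max_eq_left (sub_nonneg.2 hτm)]
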